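/- Let $N\ge 1$ be an integer, $k$ a negative integer, and $\chi$ a Dirichlet character modulo $N$ with $\chi(-1)=(-1)^k$; write $\chi(g)=\chi(d)$ for $g=\begin{pmatrix}a&b\\c&d\end{pmatrix}\in\Gamma_0(N)$. For $\gamma=\begin{pmatrix}a&b\\c&d\end{pmatrix}\in\mathrm{SL}_2(\mathbb{Z})$ and $\tau=u+iv\in\mathbb{H}$ put $j(\gamma,\tau)=c\tau+d$ and $(f|_k\gamma)(\tau)=j(\gamma,\tau)^{-k}f(\gamma\tau)$. Let $$\Delta_k=-v^2\Big(\frac{\partial^2}{\partial u^2}+\frac{\partial^2}{\partial v^2}\Big)+ikv\Big(\frac{\partial}{\partial u}+i\frac{\partial}{\partial v}\Big),\qquad \xi_k f=2iv^k\,\overline{\frac{\partial f}{\partial\bar\tau}} .$$ Let $H_k^!(N,\chi)$ be the space of harmonic Maass forms of manageable growth: smooth $f:\mathbb{H}\to\mathbb{C}$ with $f|_k\gamma=\chi(\gamma)f$ for all $\gamma\in\Gamma_0(N)$, $\Delta_kf=0$, and, for every $\gamma\in\mathrm{SL}_2(\mathbb{Z})$, $(f|_k\gamma)(\tau)=O(e^{\epsilon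 v})$ as $v\to\infty$, uniformly in $u$, for some $\epsilon>0$. Say that $f$ has at most polynomial growth at every cusp if for every $\gamma\in\mathrm{SL}_2(\mathbb{Z})$ there is an $m\ge 0$ with $(f|_k\gamma)(\tau)=O(v^m)$ as $v\to\infty$, uniformly in $u$, and let $H_k^\#(N,\chi)\subseteq H_k^!(N,\chi)$ be the subspace of forms with this property. Let $\rho\in\mathbb{Q}\cup\{i\infty\}$ be a cusp, $\gamma_\rho\in\mathrm{SL}_2(\mathbb{Z})$ with $\gamma_\rho(i\infty)=\rho$, and $\Gamma_\rho$ the stabiliser of $\rho$ in $\Gamma_0(N)$. Assume that $\chi(g)=1$ for every $g\in\Gamma_\rho$ of trace $2$ (for even $k$ this says that $\chi$ is trivial on $\Gamma_\rho$), so that the terms of the series $$\mathcal{F}_{k,\rho}(N,\chi;\tau)=\sum_{g\in\Gamma_\rho\backslash\Gamma_0(N)}\overline{\chi(g)}\,\Big(\frac{v^{1-k}}{1-k}\Big)\Big|_k\gamma_\rho^{-1}g\,(\tau),\qquad E_{2-k,\rho}(N,\overline{\chi};\tau)=\sum_{g\in\Gamma_\rho\backslash\Gamma_0(N)}\chi(g)\,j(\gamma_\rho^{-1}g,\tau)^{k-2}$$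 do not depend on the choice of coset representatives. **Theorem.** Both series converge absolutely for every $\tau\in\mathbb{H}$. The function $\mathcal{F}_{k,\rho}(N,\chi;\cdot)$ belongs to $H_k^!(N,\chi)$ and has at most polynomial growth at every cusp of $\Gamma_0(N)$; in particular it belongs to $H_k^\#(N,\chi)$. Its shadow is $\xi_k\big(\mathcal{F}_{k,\rho}(N,\chi;\tau)\big)=E_{2-k,\rho}(N,\overline{\chi};\tau)$. -/

import Mathlib

open scoped MatrixGroups ModularForm ComplexConjugate ContDiff

namespace HarmonicMaass

open UpperHalfPlane CongruenceSubgroup Matrix.SpecialLinearGroup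

noncomputable section

/-! ### Differential operators on functions `ℍ → ℂ`, with `τ = u + i v` -/

/-- A function on the upper half-plane, viewed as a function on (the upper half-plane in) `ℂ`. -/
def toComplexFun (f : ℍ → ℂ) : ℂ → ℂ := f ∘ ofComplex

/-- Smoothness (real `C^∞`) of a function on the upper half-plane. -/
def IsSmooth (f : ℍ → ℂ) : Prop := ContDiffOn ℝ ∞ (toComplexFun f) {z : ℂ | 0 < z.im}

/-- The partial derivative `∂f/∂u`. -/
def dU (f : ℍ → ℂ) (τ : ℍ) : ℂ := fderiv ℝ (toComplexFun f) (τ : ℂ) 1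

/-- The partial derivative `∂f/∂v`. -/
def dV (f : ℍ → ℂ) (τ : ℍ) : ℂ := fderiv ℝ (toComplexFun f) (τ : ℂ) Complex.I

/-- The Wirtinger derivative `∂f/∂τ̄ = (1/2) (∂f/∂u + i ∂f/∂v)`. -/
def dBar (f : ℍ → ℂ) (τ : ℍ) : ℂ := (1 / 2) * (dU f τ + Complex.I * dV f τ)

/-- The weight `k` hyperbolic Laplacian
`Δ_k = -v² (∂²/∂u² + ∂²/∂v²) + i k v (∂/∂u + i ∂/∂v)`. -/
def laplacian (k : ℤ) (f : ℍ → ℂ) (τ : ℍ) : ℂ :=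
  -(τ.im : ℂ) ^ 2 * (dU (dU f) τ + dV (dV f) τ)
    + Complex.I * k * (τ.im : ℂ) * (dU f τ + Complex.I * dV f τ)

/-- The shadow operator `ξ_k f = 2 i v^k \overline{∂f/∂τ̄}`. -/
def shadow (k : ℤ) (f : ℍ → ℂ) (τ : ℍ) : ℂ :=
  2 * Complex.I * (τ.im : ℂ) ^ k * conj (dBar f τ)

/-! ### Harmonic Maass forms for `Γ₀(N)` with character -/

/-- `χ(g) = χ(d)` for `g = (a b; c d) ∈ Γ₀(N)`. -/
def charVal {N : ℕ} (χ : DirichletCharacter ℂ N) (g : Gamma0 N) : ℂ := χ (Gamma0Map N g)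

/-- The space `H_k^!(N, χ)` of harmonic Maass forms of manageable growth. The growth condition at
the cusp `γ(i∞)` is imposed on `f|_k γ`, as `v → ∞` uniformly in `u`. -/
structure IsManageable {N : ℕ} (k : ℤ) (χ : DirichletCharacter ℂ N) (f : ℍ → ℂ) : Prop where
  smooth : IsSmooth f
  slash_eq : ∀ g : Gamma0 N, f ∣[k] (g : SL(2, ℤ)) = charVal χ g • f
  harmonic : ∀ τ : ℍ, laplacian k f τ = 0
  growth : ∀ γ : SL(2, ℤ), ∃ ε : ℝ, 0 < ε ∧
    (f ∣[k] γ) =O[atImInfty] fun τ : ℍ => Real.exp (ε * τ.im)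

/-- `f` (of weight `k`) has at most polynomial growth at every cusp: for every `γ ∈ SL₂(ℤ)`,
`f|_k γ` is bounded by a power of `v` as `v → ∞`, uniformly in `u`. -/
def PolynomialGrowthAtCusps (k : ℤ) (f : ℍ → ℂ) : Prop :=
  ∀ γ : SL(2, ℤ), ∃ m : ℕ, (f ∣[k] γ) =O[atImInfty] fun τ : ℍ => τ.im ^ m

/-- The space `H_k^#(N, χ)` of harmonic Maass forms of polynomial growth. -/
structure IsPolynomialGrowthForm {N : ℕ} (k : ℤ) (χ : DirichletCharacter ℂ N) (f : ℍ → ℂ) :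
    Prop extends IsManageable k χ f where
  polyGrowth : PolynomialGrowthAtCusps k f

/-! ### The series attached to a cusp -/

/-- The stabiliser `Γ_ρ` of the cusp `ρ ∈ ℚ ∪ {i∞}` in `Γ₀(N)`. -/
def cuspStabilizer (N : ℕ) (ρ : OnePoint ℚ) : Subgroup (Gamma0 N) :=
  (MulAction.stabilizer (GL (Fin 2) ℚ) ρ).comap ((mapGL ℚ).comp (Gamma0 N).subtype)

/-- The coset space `Γ_ρ \ Γ₀(N)` of cosets `Γ_ρ g`. -/
abbrev CuspCosets (N : ℕ) (ρ : OnePoint ℚ) : Type :=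
  Quotient (QuotientGroup.rightRel (cuspStabilizer N ρ))

/-- `χ` takes the value `1` at all `g ∈ Γ_ρ` of trace `2`, that is, at all unipotent elements of
`Γ_ρ`. Together with `χ(-1) = (-1)^k` this is what makes the series below well defined; for even
`k` it then says that `χ` is trivial on `Γ_ρ`. -/
def TrivialOnUnipotents {N : ℕ} (χ : DirichletCharacter ℂ N) (ρ : OnePoint ℚ) : Prop :=
  ∀ g ∈ cuspStabilizer N ρ,
    Matrix.trace ((g : SL(2, ℤ)) : Matrix (Fin 2) (Fin 2) ℤ) = 2 → charVal χ g = 1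

/-- `j(γ, τ) = c τ + d`. -/
def autFactor (γ : SL(2, ℤ)) (τ : ℍ) : ℂ := ((γ 1 0 : ℤ) : ℂ) * (τ : ℂ) + ((γ 1 1 : ℤ) : ℂ)

/-- The term `\overline{χ(g)} j(γ_ρ⁻¹ g, τ)^{-w}` of the Eisenstein series of weight `w`. -/
def eisTerm {N : ℕ} (w : ℤ) (χ : DirichletCharacter ℂ N) (γρ : SL(2, ℤ)) (τ : ℍ)
    (g : Gamma0 N) : ℂ :=
  conj (charVal χ g) * autFactor (γρ⁻¹ * (g : SL(2, ℤ))) τ ^ (-w)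

/-- The Eisenstein series `E_{w,ρ}(N, χ; τ)`, a sum over `Γ_ρ \ Γ₀(N)`. -/
def eisenstein {N : ℕ} (w : ℤ) (χ : DirichletCharacter ℂ N) (ρ : OnePoint ℚ) (γρ : SL(2, ℤ))
    (τ : ℍ) : ℂ :=
  ∑' q : CuspCosets N ρ, eisTerm w χ γρ τ q.out

/-- The function `v^{1-k} / (1-k)`. -/
def seed (k : ℤ) (τ : ℍ) : ℂ := (τ.im : ℂ) ^ (1 - k) / (1 - k)

/-- The term `\overline{χ(g)} (v^{1-k}/(1-k))|_k γ_ρ⁻¹ g (τ)`. -/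
def poincareTerm {N : ℕ} (k : ℤ) (χ : DirichletCharacter ℂ N) (γρ : SL(2, ℤ)) (τ : ℍ)
    (g : Gamma0 N) : ℂ :=
  conj (charVal χ g) * (seed k ∣[k] (γρ⁻¹ * (g : SL(2, ℤ)))) τ

/-- The series `𝓕_{k,ρ}(N, χ; τ)`, a sum over `Γ_ρ \ Γ₀(N)`. -/
def poincare {N : ℕ} (k : ℤ) (χ : DirichletCharacter ℂ N) (ρ : OnePoint ℚ) (γρ : SL(2, ℤ))
    (τ : ℍ) : ℂ :=
  ∑' q : CuspCosets N ρ, poincareTerm k χ γρ τ q.out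

/-! ### The terms depend only on the coset `Γ_ρ g` -/

lemma stabilizer_aux {N : ℕ} {ρ : OnePoint ℚ} {γρ : SL(2, ℤ)}
    (hρ : mapGL ℚ γρ • (OnePoint.infty : OnePoint ℚ) = ρ) {h : Gamma0 N}
    (hh : h ∈ cuspStabilizer N ρ) :
    (γρ⁻¹ * (h : SL(2, ℤ)) * γρ) 1 0 = 0 := by
  have h1 : mapGL ℚ (h : SL(2, ℤ)) • ρ = ρ := hh
  have h2 : mapGL ℚ (γρ⁻¹ * (h : SL(2, ℤ)) * γρ) • (OnePoint.infty : OnePoint ℚ)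
      = OnePoint.infty := by
    rw [map_mul, map_mul, mul_smul, mul_smul, hρ, h1, ← hρ, ← mul_smul, ← map_mul]
    simp
  generalize γρ⁻¹ * (h : SL(2, ℤ)) * γρ = m at h2 ⊢
  rw [OnePoint.smul_infty_eq_self_iff] at h2
  simpa using h2

lemma stabilizer_form {N : ℕ} {k : ℤ} {χ : DirichletCharacter ℂ N} {ρ : OnePoint ℚ}
    {γρ : SL(2, ℤ)} (hρ : mapGL ℚ γρ • (OnePoint.infty : OnePoint ℚ) = ρ)
    (hpar : χ (-1) = (-1) ^ k) (htriv : TrivialOnUnipotents χ ρ) {h : Gamma0 N}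
    (hh : h ∈ cuspStabilizer N ρ) :
    ∃ e : ℤ, (e = 1 ∨ e = -1) ∧ (γρ⁻¹ * (h : SL(2, ℤ)) * γρ) 1 0 = 0 ∧
      (γρ⁻¹ * (h : SL(2, ℤ)) * γρ) 1 1 = e ∧ charVal χ h = (e : ℂ) ^ k := by
  have h10 := stabilizer_aux hρ hh
  have htr : Matrix.trace ((γρ⁻¹ * (h : SL(2, ℤ)) * γρ : SL(2, ℤ)) : Matrix (Fin 2) (Fin 2) ℤ)
      = Matrix.trace ((h : SL(2, ℤ)) : Matrix (Fin 2) (Fin 2) ℤ) := by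
    rw [coe_mul, Matrix.trace_mul_comm, ← coe_mul, ← mul_assoc, mul_inv_cancel, one_mul]
  generalize γρ⁻¹ * (h : SL(2, ℤ)) * γρ = m at h10 htr ⊢
  have hdet : m 0 0 * m 1 1 = 1 := by
    have := m.det_coe
    rw [Matrix.det_fin_two, h10] at this
    simpa using this
  rw [Matrix.trace_fin_two] at htr
  rcases Int.eq_one_or_neg_one_of_mul_eq_one hdet with h0 | h0
  · have h1 : m 1 1 = 1 := by rw [h0] at hdet; linarith
    refine ⟨1, Or.inl rfl, h10, h1, ?_⟩
    rw [htriv h hh (by rw [← htr, h0, h1]; norm_num)]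
    simp
  · have h1 : m 1 1 = -1 := by rw [h0] at hdet; linarith
    refine ⟨-1, Or.inr rfl, h10, h1, ?_⟩
    have hneg : (-(h : SL(2, ℤ))) ∈ Gamma0 N := by
      have := h.2
      rw [Gamma0_mem] at this ⊢
      simp [this]
    have hstab : (⟨-(h : SL(2, ℤ)), hneg⟩ : Gamma0 N) ∈ cuspStabilizer N ρ := by
      have h1 : mapGL ℚ (h : SL(2, ℤ)) • ρ = ρ := hh
      have h2 : mapGL ℚ (-(h : SL(2, ℤ))) • ρ = ρ := by
        have e1 : -(h : SL(2, ℤ)) = (h : SL(2, ℤ)) * (γρ * (-1) * γρ⁻¹) := by simp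
        have e2 : mapGL ℚ (-1 : SL(2, ℤ)) • (OnePoint.infty : OnePoint ℚ) = OnePoint.infty := by
          rw [OnePoint.smul_infty_eq_self_iff]; simp
        rw [e1, map_mul, map_mul, map_mul, mul_smul, mul_smul, mul_smul, ← hρ,
          ← mul_smul (mapGL ℚ γρ⁻¹), ← map_mul, inv_mul_cancel, map_one, one_smul, e2, hρ, h1]
      exact h2
    have ht := htriv _ hstab (by
      rw [Matrix.trace_fin_two] at htr ⊢
      simp only [coe_neg, Matrix.neg_apply]
      rw [h0, h1] at htr
      linarith)
    have hc : charVal χ (⟨-(h : SL(2, ℤ)), hneg⟩ : Gamma0 N) = χ (-1) * charVal χ h := by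
      rw [charVal, charVal, ← map_mul]
      simp [Gamma0Map]
    rw [hc, hpar] at ht
    have hsq : ((-1 : ℂ) ^ k) * ((-1 : ℂ) ^ k) = 1 := by
      rw [← mul_zpow]; simp
    push_cast
    calc charVal χ h = ((-1 : ℂ) ^ k * (-1 : ℂ) ^ k) * charVal χ h := by rw [hsq, one_mul]
      _ = (-1 : ℂ) ^ k := by rw [mul_assoc, ht, mul_one]

lemma charVal_mul {N : ℕ} (χ : DirichletCharacter ℂ N) (g h : Gamma0 N) :
    charVal χ (g * h) = charVal χ g * charVal χ h := by
  simp [charVal]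

lemma eisTerm_stabilizer_mul {N : ℕ} {k : ℤ} {χ : DirichletCharacter ℂ N} {ρ : OnePoint ℚ}
    {γρ : SL(2, ℤ)} (hρ : mapGL ℚ γρ • (OnePoint.infty : OnePoint ℚ) = ρ)
    (hpar : χ (-1) = (-1) ^ k) (htriv : TrivialOnUnipotents χ ρ) {h : Gamma0 N}
    (hh : h ∈ cuspStabilizer N ρ) (g : Gamma0 N) (τ : ℍ) :
    eisTerm k χ γρ τ (h * g) = eisTerm k χ γρ τ g := by
  obtain ⟨e, he, h10, h11, hχ⟩ := stabilizer_form hρ hpar htriv hh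
  have hm : γρ⁻¹ * ((h * g : Gamma0 N) : SL(2, ℤ))
      = (γρ⁻¹ * (h : SL(2, ℤ)) * γρ) * (γρ⁻¹ * (g : SL(2, ℤ))) := by
    push_cast; group
  have hj : autFactor (γρ⁻¹ * ((h * g : Gamma0 N) : SL(2, ℤ))) τ
      = e * autFactor (γρ⁻¹ * (g : SL(2, ℤ))) τ := by
    rw [hm]
    generalize γρ⁻¹ * (h : SL(2, ℤ)) * γρ = m at h10 h11 ⊢
    generalize γρ⁻¹ * (g : SL(2, ℤ)) = n
    simp only [autFactor, coe_mul, Matrix.mul_apply, Fin.sum_univ_two, h10, h11]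
    push_cast
    ring
  rw [eisTerm, eisTerm, hj, charVal_mul, hχ, mul_zpow]
  rcases he with rfl | rfl
  · simp
  · have hsq : ((-1 : ℂ) ^ k) * ((-1 : ℂ) ^ (-k)) = 1 := by
      rw [← zpow_add₀ (by norm_num)]; simp
    simp only [map_mul, map_zpow₀, Int.cast_neg, Int.cast_one, map_neg, map_one]
    linear_combination (conj (charVal χ g) * autFactor (γρ⁻¹ * (g : SL(2, ℤ))) τ ^ (-k)) * hsq

lemma poincareTerm_eq {N : ℕ} (k : ℤ) (χ : DirichletCharacter ℂ N) (γρ : SL(2, ℤ)) (τ : ℍ)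
    (g : Gamma0 N) :
    poincareTerm k χ γρ τ g =
      eisTerm k χ γρ τ g * seed k ((γρ⁻¹ * (g : SL(2, ℤ))) • τ) := by
  rw [poincareTerm, eisTerm, ModularForm.SL_slash_apply]
  have : denom (γρ⁻¹ * (g : SL(2, ℤ)) : SL(2, ℤ)) τ
      = autFactor (γρ⁻¹ * (g : SL(2, ℤ))) τ := by
    generalize γρ⁻¹ * (g : SL(2, ℤ)) = n
    simp [denom, autFactor]
  rw [this]
  ring

lemma poincareTerm_stabilizer_mul {N : ℕ} {k : ℤ} {χ : DirichletCharacter ℂ N} {ρ : OnePoint ℚ}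
    {γρ : SL(2, ℤ)} (hρ : mapGL ℚ γρ • (OnePoint.infty : OnePoint ℚ) = ρ)
    (hpar : χ (-1) = (-1) ^ k) (htriv : TrivialOnUnipotents χ ρ) {h : Gamma0 N}
    (hh : h ∈ cuspStabilizer N ρ) (g : Gamma0 N) (τ : ℍ) :
    poincareTerm k χ γρ τ (h * g) = poincareTerm k χ γρ τ g := by
  rw [poincareTerm_eq, poincareTerm_eq, eisTerm_stabilizer_mul hρ hpar htriv hh]
  congr 1
  obtain ⟨e, he, h10, h11, -⟩ := stabilizer_form hρ hpar htriv hh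
  have hm : γρ⁻¹ * ((h * g : Gamma0 N) : SL(2, ℤ))
      = (γρ⁻¹ * (h : SL(2, ℤ)) * γρ) * (γρ⁻¹ * (g : SL(2, ℤ))) := by
    push_cast; group
  rw [hm, mul_smul]
  generalize γρ⁻¹ * (h : SL(2, ℤ)) * γρ = m at h10 h11 ⊢
  generalize (γρ⁻¹ * (g : SL(2, ℤ))) • τ = z
  have him : (m • z).im = z.im := by
    rw [ModularGroup.im_smul_eq_div_normSq]
    have : denom m z = (e : ℂ) := by simp [denom, h10, h11]
    rw [this]
    rcases he with rfl | rfl <;> simp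
  rw [seed, seed, him]

end

end HarmonicMaass

namespace HarmonicMaass

open UpperHalfPlane CongruenceSubgroup Matrix.SpecialLinearGroup

noncomputable section

/-! ### Lattice sums `∑ aᵢ cᵢ^m (cᵢ z + dᵢ)^p \overline{(cᵢ z + dᵢ)}^q` -/

/-! Write `j = cτ + d` for the bottom row `(c, d)` of `γ`. Since `Im γτ = v / (j * conj j)`,
slashing the seed gives `v^(1-k)/(1-k) * j^(-1) * (conj j)^(k-1)`. So the series, and each of its
slashes by `SL(2, ℤ)`, is `v^(1-k)/(1-k)` times a sum over integer rows. Distinct cosets have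
distinct rows, and the terms have total degree `k - 2 ≤ -3`. This is enough for absolute convergence
over a rank-two lattice.

The family `c^m * j^p * (conj j)^q` is closed under both Wirtinger derivatives: each raises `m` by
one and lowers `p` or `q` by one, so `p + q + m` is constant. As `|c| ≤ |j| / Im z`, one lattice
majorant serves all derivatives, which gives smoothness and termwise differentiation
(`hasFDerivAt_latSum`, `contDiffOn_latSum`).

The identity `j = conj j + 2ivc` collapses the `τ̄`-derivative to `(i/2) * v^(-k) * ∑ a * (conj
j)^(k-2)` (`dBar_of_eq_latSum`). Conjugating it yields the Eisenstein series as shadow. Because the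
sum is antiholomorphic, the two terms of `Δ_k = -4v² ∂_τ ∂_τ̄ + 2ikv ∂_τ̄` cancel.

The transformation law comes from right multiplication permuting the cosets. Growth comes from
bounding the row sum uniformly on `Im z ≥ 1` (`exists_norm_latSum_le`), so every slash is
`O(v^(1-k))`. -/

/-- The function `c^m (c z + d)^p \overline{(c z + d)}^q`, where `x = (c, d)`. -/
def latTerm (x : Fin 2 → ℤ) (m : ℕ) (p q : ℤ) (z : ℂ) : ℂ :=
  (x 0 : ℂ) ^ m * ((x 0 : ℂ) * z + x 1) ^ p * conj ((x 0 : ℂ) * z + x 1) ^ q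

/-- The sum of the functions `latTerm (x i) m p q` with coefficients `a i`. -/
def latSum {ι : Type*} (a : ι → ℂ) (x : ι → Fin 2 → ℤ) (m : ℕ) (p q : ℤ) (z : ℂ) : ℂ :=
  ∑' i, a i * latTerm (x i) m p q z

lemma linear_ne_zero {x : Fin 2 → ℤ} (hx : x ≠ 0) {z : ℂ} (hz : 0 < z.im) :
    (x 0 : ℂ) * z + x 1 ≠ 0 := by
  have h := EisensteinSeries.r_mul_max_le ⟨z, hz⟩ hx
  have h1 := mul_pos (EisensteinSeries.r_pos ⟨z, hz⟩) (norm_pos_iff.mpr hx)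
  exact norm_pos_iff.mp (h1.trans_le h)

lemma summable_norm_zpow {s : ℤ} (hs : s ≤ -3) :
    Summable fun x : Fin 2 → ℤ ↦ ‖x‖ ^ s := by
  have hs' : (2 : ℝ) < ((-s : ℤ) : ℝ) := by exact_mod_cast (by omega : (2 : ℤ) < -s)
  refine (EisensteinSeries.summable_one_div_norm_rpow hs').congr fun x ↦ ?_
  rw [← Real.rpow_intCast]
  push_cast
  rw [neg_neg]

lemma norm_linear_zpow_le (x : Fin 2 → ℤ) {s : ℤ} (hs : s ≤ 0) {A B : ℝ}
    (hB : 0 < B) {z : ℂ} (hA : |z.re| ≤ A) (hz : B ≤ z.im) :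
    ‖(x 0 : ℂ) * z + x 1‖ ^ s ≤ EisensteinSeries.r ⟨⟨A, B⟩, hB⟩ ^ s * ‖x‖ ^ s := by
  have h := EisensteinSeries.summand_bound_of_mem_verticalStrip (z := ⟨z, hB.trans_le hz⟩)
    (k := -s) (by exact_mod_cast neg_nonneg.mpr hs) x hB ⟨hA, hz⟩
  simpa [Real.rpow_intCast] using h

/-- Since `Im (cz + d) = c * Im z`, the factor `|c|` is at most `|cz + d| / B`. Each power of `c`
thus costs one power of `cz + d`, and only the total degree `p + q + m` matters. -/
lemma norm_latTerm_le {x : Fin 2 → ℤ} (hx : x ≠ 0) {m : ℕ} {p q : ℤ} (hs : p + q + m ≤ 0)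
    {A B : ℝ} (hB : 0 < B) {z : ℂ} (hA : |z.re| ≤ A) (hz : B ≤ z.im) :
    ‖latTerm x m p q z‖ ≤
      (B ^ m)⁻¹ * EisensteinSeries.r ⟨⟨A, B⟩, hB⟩ ^ (p + q + m) * ‖x‖ ^ (p + q + m) := by
  have hj := linear_ne_zero hx (hB.trans_le hz)
  have hj' : ‖(x 0 : ℂ) * z + x 1‖ ≠ 0 := norm_ne_zero_iff.mpr hj
  have h0 : ‖(x 0 : ℂ)‖ ≤ B⁻¹ * ‖(x 0 : ℂ) * z + x 1‖ := by
    rw [← div_eq_inv_mul, le_div_iff₀ hB]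
    have h1 := Complex.abs_im_le_norm ((x 0 : ℂ) * z + x 1)
    have h2 : ((x 0 : ℂ) * z + x 1).im = x 0 * z.im := by simp
    rw [h2, abs_mul, abs_of_pos (hB.trans_le hz)] at h1
    rw [Complex.norm_intCast]
    exact (mul_le_mul_of_nonneg_left hz (abs_nonneg _)).trans h1
  calc ‖latTerm x m p q z‖
      = ‖(x 0 : ℂ)‖ ^ m * ‖(x 0 : ℂ) * z + x 1‖ ^ (p + q) := by
        simp only [latTerm, norm_mul, norm_pow, norm_zpow, Complex.norm_conj]
        rw [zpow_add₀ hj', mul_assoc]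
    _ ≤ (B⁻¹ * ‖(x 0 : ℂ) * z + x 1‖) ^ m * ‖(x 0 : ℂ) * z + x 1‖ ^ (p + q) := by gcongr
    _ = (B ^ m)⁻¹ * ‖(x 0 : ℂ) * z + x 1‖ ^ (p + q + m) := by
        rw [zpow_add₀ hj' (p + q), mul_pow, inv_pow, zpow_natCast]; ring
    _ ≤ _ := by
        rw [mul_assoc]
        exact mul_le_mul_of_nonneg_left (norm_linear_zpow_le x hs hB hA hz) (by positivity)

/-! ### Convergence and termwise differentiation of lattice sums -/

section

variable {ι : Type*} {a : ι → ℂ} {x : ι → Fin 2 → ℤ} {m : ℕ} {p q : ℤ}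

lemma summable_norm_latTerm (ha : ∀ i, ‖a i‖ ≤ 1) (hx : ∀ i, x i ≠ 0)
    (hinj : Function.Injective x) (hs : p + q + m ≤ -3) {z : ℂ} (hz : 0 < z.im) :
    Summable fun i ↦ ‖a i * latTerm (x i) m p q z‖ := by
  refine Summable.of_nonneg_of_le (fun _ ↦ norm_nonneg _) (fun i ↦ ?_)
    (((summable_norm_zpow hs).comp_injective hinj).mul_left
      ((z.im ^ m)⁻¹ * EisensteinSeries.r ⟨⟨|z.re|, z.im⟩, hz⟩ ^ (p + q + m)))
  rw [norm_mul]
  refine (mul_le_of_le_one_left (norm_nonneg _) (ha i)).trans ?_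
  exact norm_latTerm_le (hx i) (by omega) hz le_rfl le_rfl

lemma hasSum_latSum (ha : ∀ i, ‖a i‖ ≤ 1) (hx : ∀ i, x i ≠ 0)
    (hinj : Function.Injective x) (hs : p + q + m ≤ -3) {z : ℂ} (hz : 0 < z.im) :
    HasSum (fun i ↦ a i * latTerm (x i) m p q z) (latSum a x m p q z) :=
  (summable_norm_latTerm ha hx hinj hs hz).of_norm.hasSum

/-- The real-linear map `h ↦ s h + t \overline{h}`. -/
def wirtinger (s t : ℂ) : ℂ →L[ℝ] ℂ :=
  s • (1 : ℂ →L[ℝ] ℂ) + t • (Complex.conjCLE : ℂ →L[ℝ] ℂ)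

lemma wirtinger_apply (s t h : ℂ) : wirtinger s t h = s * h + t * conj h := by
  simp [wirtinger]

lemma smul_wirtinger (c s t : ℂ) : c • wirtinger s t = wirtinger (c * s) (c * t) := by
  ext h
  simp only [_root_.smul_apply, wirtinger_apply, smul_eq_mul]
  ring

lemma norm_wirtinger_le (s t : ℂ) : ‖wirtinger s t‖ ≤ ‖s‖ + ‖t‖ := by
  refine ContinuousLinearMap.opNorm_le_bound _ (by positivity) fun h ↦ ?_
  rw [wirtinger_apply, add_mul]
  refine (norm_add_le _ _).trans_eq ?_
  simp

lemma HasSum.wirtinger {s t : ι → ℂ} {S T : ℂ} (hs : HasSum s S) (ht : HasSum t T) :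
    HasSum (fun i ↦ wirtinger (s i) (t i)) (wirtinger S T) :=
  (hs.smul_const (1 : ℂ →L[ℝ] ℂ)).add (ht.smul_const (Complex.conjCLE : ℂ →L[ℝ] ℂ))

lemma hasFDerivAt_latTerm {x : Fin 2 → ℤ} (hx : x ≠ 0) {z : ℂ} (hz : 0 < z.im) :
    HasFDerivAt (latTerm x m p q)
      (wirtinger (p * latTerm x (m + 1) (p - 1) q z) (q * latTerm x (m + 1) p (q - 1) z)) z := by
  have hj := linear_ne_zero hx hz
  have hl : HasDerivAt (fun w : ℂ ↦ (x 0 : ℂ) * w + x 1) (x 0 : ℂ) z := by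
    simpa using ((hasDerivAt_id z).const_mul (x 0 : ℂ)).add_const (x 1 : ℂ)
  have hpow (n : ℤ) : HasFDerivAt (fun w : ℂ ↦ ((x 0 : ℂ) * w + x 1) ^ n)
      (((n : ℂ) * ((x 0 : ℂ) * z + x 1) ^ (n - 1) * (x 0 : ℂ)) • (1 : ℂ →L[ℝ] ℂ)) z := by
    have h := hasDerivAt_zpow n ((x 0 : ℂ) * z + x 1) (Or.inl hj)
    exact (h.comp z hl).complexToReal_fderiv
  have hconj : HasFDerivAt (fun w : ℂ ↦ conj ((x 0 : ℂ) * w + x 1) ^ q)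
      ((Complex.conjCLE : ℂ →L[ℝ] ℂ).comp
        (((q : ℂ) * ((x 0 : ℂ) * z + x 1) ^ (q - 1) * (x 0 : ℂ)) • (1 : ℂ →L[ℝ] ℂ))) z := by
    have := (Complex.conjCLE : ℂ →L[ℝ] ℂ).hasFDerivAt.comp z (hpow q)
    refine this.congr_of_eventuallyEq (Filter.Eventually.of_forall fun w ↦ ?_)
    simp [map_zpow₀]
  refine (((hpow p).const_mul ((x 0 : ℂ) ^ m)).mul hconj).congr_fderiv ?_
  ext h
  simp [wirtinger_apply, latTerm, map_zpow₀, pow_succ]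
  ring

/-- Differentiating preserves `p + q + m`, so the differentiated series has a majorant of the same
degree, uniform near `z`. -/
lemma hasFDerivAt_latSum (ha : ∀ i, ‖a i‖ ≤ 1) (hx : ∀ i, x i ≠ 0)
    (hinj : Function.Injective x) (hs : p + q + m ≤ -3) {z : ℂ} (hz : 0 < z.im) :
    HasFDerivAt (latSum a x m p q)
      (wirtinger (p * latSum a x (m + 1) (p - 1) q z) (q * latSum a x (m + 1) p (q - 1) z)) z := by
  have hs1 : p - 1 + q + (m + 1 : ℕ) = p + q + m := by push_cast; ring
  have hs2 : p + (q - 1) + (m + 1 : ℕ) = p + q + m := by push_cast; ring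
  have hB : 0 < z.im / 2 := by positivity
  -- A convex open half-strip around `z`, with bounded real part and imaginary part bounded away
  -- from `0`; the row estimates are uniform there.
  let U : Set ℂ := Complex.re ⁻¹' Set.Ioo (-(|z.re| + 1)) (|z.re| + 1) ∩
    Complex.im ⁻¹' Set.Ioi (z.im / 2)
  have hUo : IsOpen U :=
    (isOpen_Ioo.preimage Complex.continuous_re).inter (isOpen_Ioi.preimage Complex.continuous_im)
  have hUc : IsPreconnected U :=
    (((convex_Ioo _ _).linear_preimage Complex.reLm).inter
      ((convex_Ioi _).linear_preimage Complex.imLm)).isPreconnected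
  have hzU : z ∈ U := by
    refine ⟨⟨?_, ?_⟩, ?_⟩
    · linarith [neg_abs_le z.re]
    · linarith [le_abs_self z.re]
    · exact half_lt_self hz
  have hUim {w : ℂ} (hw : w ∈ U) : 0 < w.im := hB.trans hw.2
  -- The power is `m + 1` because `C` bounds the differentiated terms; their degree is still `p + q
  -- + m`.
  set C := ((z.im / 2) ^ (m + 1))⁻¹ *
    EisensteinSeries.r ⟨⟨|z.re| + 1, z.im / 2⟩, hB⟩ ^ (p + q + m)
  have hbound (i : ι) (w : ℂ) (hw : w ∈ U) :
      ‖a i • wirtinger (p * latTerm (x i) (m + 1) (p - 1) q w)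
        (q * latTerm (x i) (m + 1) p (q - 1) w)‖ ≤
      (‖(p : ℂ)‖ + ‖(q : ℂ)‖) * C * ‖x i‖ ^ (p + q + m) := by
    have hre : |w.re| ≤ |z.re| + 1 := (abs_lt.mpr hw.1).le
    have h1 := norm_latTerm_le (hx i) (m := m + 1) (p := p - 1) (q := q) (by omega) hB hre
      (le_of_lt hw.2)
    have h2 := norm_latTerm_le (hx i) (m := m + 1) (p := p) (q := q - 1) (by omega) hB hre
      (le_of_lt hw.2)
    rw [hs1] at h1
    rw [hs2] at h2
    rw [norm_smul]
    refine (mul_le_of_le_one_left (norm_nonneg _) (ha i)).trans ?_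
    refine (norm_wirtinger_le _ _).trans ?_
    rw [norm_mul, norm_mul, mul_assoc, add_mul]
    exact add_le_add (mul_le_mul_of_nonneg_left h1 (norm_nonneg _))
      (mul_le_mul_of_nonneg_left h2 (norm_nonneg _))
  have h := hasFDerivAt_tsum_of_isPreconnected
    (((summable_norm_zpow hs).comp_injective hinj).mul_left ((‖(p : ℂ)‖ + ‖(q : ℂ)‖) * C))
    hUo hUc (f := fun i w ↦ a i * latTerm (x i) m p q w)
    (fun i w hw ↦ (hasFDerivAt_latTerm (hx i) (hUim hw)).const_mul (a i)) hbound hzU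
    (hasSum_latSum ha hx hinj hs hz).summable hzU
  refine h.congr_fderiv (HasSum.tsum_eq ?_)
  simp only [smul_wirtinger, mul_left_comm (a _)]
  exact HasSum.wirtinger ((hasSum_latSum ha hx hinj (hs1.trans_le hs) hz).mul_left _)
    ((hasSum_latSum ha hx hinj (hs2.trans_le hs) hz).mul_left _)

lemma isOpen_im_pos : IsOpen {z : ℂ | 0 < z.im} := isOpen_lt continuous_const Complex.continuous_im

/-- The derivative is built from two sums of the same family with the same total degree, so
induction on the order of differentiability applies once `m`, `p`, `q` are generalized. -/
lemma contDiffOn_latSum (ha : ∀ i, ‖a i‖ ≤ 1) (hx : ∀ i, x i ≠ 0)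
    (hinj : Function.Injective x) (hs : p + q + m ≤ -3) :
    ContDiffOn ℝ ∞ (latSum a x m p q) {z : ℂ | 0 < z.im} := by
  rw [contDiffOn_infty]
  intro n
  induction n generalizing m p q with
  | zero =>
    refine contDiffOn_zero.mpr fun z hz ↦ ?_
    exact (hasFDerivAt_latSum ha hx hinj hs hz).continuousAt.continuousWithinAt
  | succ n ih =>
    push_cast
    rw [contDiffOn_succ_iff_fderiv_of_isOpen isOpen_im_pos]
    refine ⟨fun z hz ↦
      (hasFDerivAt_latSum ha hx hinj hs hz).differentiableAt.differentiableWithinAt, ?_, ?_⟩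
    · intro h
      exact absurd h (by simp)
    have h1 := ih (m := m + 1) (p := p - 1) (q := q) (by push_cast; omega)
    have h2 := ih (m := m + 1) (p := p) (q := q - 1) (by push_cast; omega)
    refine ContDiffOn.congr ?_ fun z hz ↦ (hasFDerivAt_latSum ha hx hinj hs hz).fderiv
    exact ((contDiffOn_const.mul h1).smul contDiffOn_const).add
      ((contDiffOn_const.mul h2).smul contDiffOn_const)

end

/-! ### Wirtinger calculus on the upper half-plane -/

lemma HasFDerivAt.mul_wirtinger {f g : ℂ → ℂ} {s t s' t' z : ℂ}
    (hf : HasFDerivAt f (wirtinger s t) z) (hg : HasFDerivAt g (wirtinger s' t') z) :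
    HasFDerivAt (fun w ↦ f w * g w)
      (wirtinger (f z * s' + g z * s) (f z * t' + g z * t)) z := by
  refine (hf.mul hg).congr_fderiv ?_
  ext h
  simp [wirtinger_apply]
  ring

/-- From `v = (z - conj z) / (2i)`, the two Wirtinger derivatives of `v` are `-i/2` and `i/2`. -/
lemma hasFDerivAt_im_zpow (n : ℤ) {z : ℂ} (hz : 0 < z.im) :
    HasFDerivAt (fun w : ℂ ↦ (w.im : ℂ) ^ n)
      (wirtinger (-(Complex.I / 2) * (n * (z.im : ℂ) ^ (n - 1)))
        (Complex.I / 2 * (n * (z.im : ℂ) ^ (n - 1)))) z := by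
  have h1 : HasFDerivAt (fun w : ℂ ↦ (w.im : ℂ)) (Complex.ofRealCLM.comp Complex.imCLM) z :=
    (Complex.ofRealCLM.comp Complex.imCLM).hasFDerivAt
  have h2 := (hasDerivAt_zpow n (z.im : ℂ)
    (Or.inl (Complex.ofReal_ne_zero.mpr hz.ne'))).complexToReal_fderiv
  refine (h2.comp z h1).congr_fderiv ?_
  ext h
  simp [wirtinger_apply]
  have hc := Complex.sub_conj h
  push_cast at hc
  linear_combination (n : ℂ) * (z.im : ℂ) ^ (n - 1) *
    (Complex.I / 2 * hc + h.im * Complex.I_sq)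

lemma toComplexFun_apply (f : ℍ → ℂ) {z : ℂ} (hz : 0 < z.im) :
    toComplexFun f z = f ⟨z, hz⟩ := by
  rw [toComplexFun, Function.comp_apply, ofComplex_apply_of_im_pos hz]

lemma toComplexFun_eventuallyEq {f : ℍ → ℂ} {F : ℂ → ℂ} (h : ∀ τ : ℍ, f τ = F τ) (τ : ℍ) :
    toComplexFun f =ᶠ[nhds (τ : ℂ)] F := by
  filter_upwards [isOpen_im_pos.mem_nhds τ.im_pos] with z hz
  rw [toComplexFun_apply f hz, h]

lemma dBar_eq_of_hasFDerivAt {f : ℍ → ℂ} {τ : ℍ} {s t : ℂ}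
    (h : HasFDerivAt (toComplexFun f) (wirtinger s t) τ) : dBar f τ = t := by
  rw [dBar, dU, dV, h.fderiv, wirtinger_apply, wirtinger_apply, map_one, Complex.conj_I]
  linear_combination (s - t) / 2 * Complex.I_sq

/-- This is the factorization `Δ_k = -4v² ∂_τ ∂_τ̄ + 2ikv ∂_τ̄`. Smoothness of `f` enters through
the symmetry of the mixed second partials. -/
lemma laplacian_eq_of_hasFDerivAt_dBar (k : ℤ) {f : ℍ → ℂ} (hf : IsSmooth f) {τ : ℍ} {s t : ℂ}
    (h : HasFDerivAt (toComplexFun (dBar f)) (wirtinger s t) τ) :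
    laplacian k f τ =
      -4 * (τ.im : ℂ) ^ 2 * s + 2 * Complex.I * k * (τ.im : ℂ) * dBar f τ := by
  have hcd : ContDiffAt ℝ ∞ (toComplexFun f) τ :=
    hf.contDiffAt (isOpen_im_pos.mem_nhds τ.im_pos)
  have hD : HasFDerivAt (fderiv ℝ (toComplexFun f))
      (fderiv ℝ (fderiv ℝ (toComplexFun f)) (τ : ℂ)) τ :=
    ((hcd.fderiv_right (m := 1) (by norm_cast)).differentiableAt (by norm_num)).hasFDerivAt
  have hsymm := (hcd.isSymmSndFDerivAt (by simp; norm_cast)) 1 Complex.I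
  set D := fderiv ℝ (fderiv ℝ (toComplexFun f)) (τ : ℂ)
  have hu : HasFDerivAt (toComplexFun (dU f)) (D.flip 1) τ :=
    (hD.clm_apply (hasFDerivAt_const (1 : ℂ) _)).congr_of_eventuallyEq
      (toComplexFun_eventuallyEq (fun _ ↦ rfl) τ) |>.congr_fderiv (by ext; simp)
  have hv : HasFDerivAt (toComplexFun (dV f)) (D.flip Complex.I) τ :=
    (hD.clm_apply (hasFDerivAt_const Complex.I _)).congr_of_eventuallyEq
      (toComplexFun_eventuallyEq (fun _ ↦ rfl) τ) |>.congr_fderiv (by ext; simp)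
  have hb : HasFDerivAt (toComplexFun (dBar f))
      ((1 / 2 : ℂ) • (D.flip 1 + Complex.I • D.flip Complex.I)) τ :=
    (hu.add (hv.const_mul Complex.I)).const_mul (1 / 2 : ℂ)
  -- The derivative of `dBar f` is now known in two ways. Evaluating at `1` and at `i`, the
  -- combination `h1 - i * h2` isolates `2s` and produces the Euclidean Laplacian.
  have hst := h.unique hb
  have h1 := congrArg (fun L : ℂ →L[ℝ] ℂ ↦ L 1) hst
  have h2 := congrArg (fun L : ℂ →L[ℝ] ℂ ↦ L Complex.I) hst
  simp [wirtinger_apply] at h1 h2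
  rw [laplacian, dBar]
  rw [dU, hu.fderiv, dV, hv.fderiv]
  simp only [ContinuousLinearMap.flip_apply]
  rw [← hsymm] at h2
  linear_combination (2 * (τ.im : ℂ) ^ 2) * (h1 - Complex.I * h2) + (τ.im : ℂ) ^ 2 *
    (2 * s - 2 * t - D Complex.I Complex.I) * Complex.I_sq

/-! ### Harmonicity and shadow of `v^{1-k} ∑ aᵢ j^{-1} \overline{j}^{k-1}` -/

section

variable {ι : Type*} {a : ι → ℂ} {x : ι → Fin 2 → ℤ} {k : ℤ} {f : ℍ → ℂ}

lemma contDiffOn_im_zpow (n : ℤ) :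
    ContDiffOn ℝ ∞ (fun z : ℂ ↦ (z.im : ℂ) ^ n) {z : ℂ | 0 < z.im} := by
  intro z hz
  have h1 : ContDiffAt ℝ ∞ (fun w : ℂ ↦ (w.im : ℂ)) z :=
    (Complex.ofRealCLM.comp Complex.imCLM).contDiff.contDiffAt
  have h0 : (z.im : ℂ) ≠ 0 := Complex.ofReal_ne_zero.mpr (ne_of_gt hz)
  refine ContDiffAt.contDiffWithinAt ?_
  cases n with
  | ofNat n => simpa using h1.pow n
  | negSucc n =>
    simp only [zpow_negSucc]
    exact (h1.pow (n + 1)).inv (pow_ne_zero _ h0)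

lemma isSmooth_of_eq_latSum (ha : ∀ i, ‖a i‖ ≤ 1) (hx : ∀ i, x i ≠ 0)
    (hinj : Function.Injective x) (hk : k < 0)
    (hf : ∀ τ : ℍ, f τ = (τ.im : ℂ) ^ (1 - k) / (1 - k) * latSum a x 0 (-1) (k - 1) τ) :
    IsSmooth f := by
  have h := ((contDiffOn_im_zpow (1 - k)).div_const (1 - k : ℂ)).mul
    (contDiffOn_latSum (m := 0) (p := -1) (q := k - 1) ha hx hinj (by push_cast; omega))
  exact h.congr fun z hz ↦ (toComplexFun_apply f hz).trans (hf ⟨z, hz⟩)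

/-- This is `j = conj j + 2ivc` multiplied by `j^(-1) * (conj j)^(k-2)`; it removes the
non-antiholomorphic factor `j^(-1)`. -/
lemma latTerm_add_eq {x : Fin 2 → ℤ} (hx : x ≠ 0) {z : ℂ} (hz : 0 < z.im) :
    latTerm x 0 (-1) (k - 1) z + 2 * Complex.I * z.im * latTerm x 1 (-1) (k - 2) z =
      latTerm x 0 0 (k - 2) z := by
  have hj := linear_ne_zero hx hz
  have hj' : conj ((x 0 : ℂ) * z + x 1) ≠ 0 := (map_ne_zero _).mpr hj
  have him : (x 0 : ℂ) * z + x 1 =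
      conj ((x 0 : ℂ) * z + x 1) + 2 * Complex.I * z.im * x 0 := by
    apply Complex.ext
    · simp
    · simp; ring
  have hq : k - 1 = k - 2 + 1 := by ring
  simp only [latTerm, hq, zpow_add₀ hj', zpow_neg_one, zpow_one, pow_zero, pow_one, zpow_zero,
    one_mul]
  set w := conj ((x 0 : ℂ) * z + x 1)
  set j := (x 0 : ℂ) * z + x 1
  field_simp
  rw [him]

lemma latSum_add_eq (ha : ∀ i, ‖a i‖ ≤ 1) (hx : ∀ i, x i ≠ 0)
    (hinj : Function.Injective x) (hk : k < 0) {z : ℂ} (hz : 0 < z.im) :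
    latSum a x 0 (-1) (k - 1) z + 2 * Complex.I * z.im * latSum a x 1 (-1) (k - 2) z =
      latSum a x 0 0 (k - 2) z := by
  have h1 := hasSum_latSum (m := 0) (p := -1) (q := k - 1) ha hx hinj (by push_cast; omega) hz
  have h2 := hasSum_latSum (m := 1) (p := -1) (q := k - 2) ha hx hinj (by push_cast; omega) hz
  rw [← (h1.add (h2.mul_left (2 * Complex.I * z.im))).tsum_eq, latSum]
  refine tsum_congr fun i ↦ ?_
  rw [← latTerm_add_eq (hx i) hz]
  ring

/-- By the product rule, differentiating `v^(1-k)` and the sum gives the two terms on the left of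
`latSum_add_eq`, up to the common factor `(i/2) * v^(-k)`. -/
lemma dBar_of_eq_latSum (ha : ∀ i, ‖a i‖ ≤ 1) (hx : ∀ i, x i ≠ 0)
    (hinj : Function.Injective x) (hk : k < 0)
    (hf : ∀ τ : ℍ, f τ = (τ.im : ℂ) ^ (1 - k) / (1 - k) * latSum a x 0 (-1) (k - 1) τ) (τ : ℍ) :
    dBar f τ = Complex.I / 2 * (τ.im : ℂ) ^ (-k) * latSum a x 0 0 (k - 2) τ := by
  have hk' : (1 - k : ℂ) ≠ 0 := by exact_mod_cast (by omega : (1 - k : ℤ) ≠ 0)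
  have hv : (τ.im : ℂ) ≠ 0 := Complex.ofReal_ne_zero.mpr τ.im_pos.ne'
  have h1 := hasFDerivAt_im_zpow (1 - k) τ.im_pos
  have h2 := hasFDerivAt_latSum (m := 0) (p := -1) (q := k - 1) ha hx hinj
    (by push_cast; omega) τ.im_pos
  have h3 := (HasFDerivAt.mul_wirtinger h1 h2).const_mul (1 - k : ℂ)⁻¹
  rw [smul_wirtinger] at h3
  rw [dBar_eq_of_hasFDerivAt (h3.congr_of_eventuallyEq
    (toComplexFun_eventuallyEq (fun τ ↦ (hf τ).trans (by simp only [coe_im]; ring)) τ)),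
    ← latSum_add_eq ha hx hinj hk τ.im_pos]
  have e1 : 1 - k - 1 = -k := by ring
  have e2 : k - 1 - 1 = k - 2 := by ring
  have e3 : (τ.im : ℂ) ^ (1 - k) = τ.im * (τ.im : ℂ) ^ (-k) := by
    rw [sub_eq_add_neg, zpow_add₀ hv, zpow_one]
  simp only [coe_im, e1, e2, e3, zero_add]
  push_cast
  field_simp
  linear_combination (-2 * (1 - k : ℂ) * τ.im * latSum a x 1 (-1) (k - 2) τ) * Complex.I_sq

/-- The sum in `dBar f` has `p = 0`, so it is antiholomorphic and `∂_τ` acts only on `v^(-k)`. The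
second-order term then equals `k * v^(1-k)` times the sum, and the first-order term is its negative.
-/
lemma laplacian_of_eq_latSum (ha : ∀ i, ‖a i‖ ≤ 1) (hx : ∀ i, x i ≠ 0)
    (hinj : Function.Injective x) (hk : k < 0)
    (hf : ∀ τ : ℍ, f τ = (τ.im : ℂ) ^ (1 - k) / (1 - k) * latSum a x 0 (-1) (k - 1) τ) (τ : ℍ) :
    laplacian k f τ = 0 := by
  have hv : (τ.im : ℂ) ≠ 0 := Complex.ofReal_ne_zero.mpr τ.im_pos.ne'
  have hd := dBar_of_eq_latSum ha hx hinj hk hf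
  have h1 := hasFDerivAt_im_zpow (-k) τ.im_pos
  have h2 := hasFDerivAt_latSum (m := 0) (p := 0) (q := k - 2) ha hx hinj
    (by push_cast; omega) τ.im_pos
  have h3 := (HasFDerivAt.mul_wirtinger h1 h2).const_mul (Complex.I / 2)
  rw [smul_wirtinger] at h3
  rw [laplacian_eq_of_hasFDerivAt_dBar k (isSmooth_of_eq_latSum ha hx hinj hk hf)
    (h3.congr_of_eventuallyEq (toComplexFun_eventuallyEq
      (fun τ ↦ (hd τ).trans (by simp only [coe_im]; ring)) τ)), hd]
  have e1 : (τ.im : ℂ) ^ (-k) = τ.im * (τ.im : ℂ) ^ (-k - 1) := by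
    rw [zpow_sub₀ hv, zpow_one, mul_div_cancel₀ _ hv]
  simp only [coe_im, e1]
  push_cast
  ring_nf

end

/-! ### Boundedness of lattice sums near `i∞` -/

/-- Translating `z` by an integer shears the rows and keeps them distinct and nonzero. The real part
can therefore be taken in `[0, 1)`, where the sum over all of `ℤ²` is a uniform majorant. -/
lemma exists_norm_latSum_le {ι : Type*} {a : ι → ℂ} {x : ι → Fin 2 → ℤ} {m : ℕ} {p q : ℤ}
    (ha : ∀ i, ‖a i‖ ≤ 1) (hx : ∀ i, x i ≠ 0) (hinj : Function.Injective x)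
    (hs : p + q + m ≤ -3) :
    ∃ C : ℝ, ∀ z : ℂ, 1 ≤ z.im → ‖latSum a x m p q z‖ ≤ C := by
  let D : ℝ := ((1 : ℝ) ^ m)⁻¹ * EisensteinSeries.r ⟨⟨1, 1⟩, one_pos⟩ ^ (p + q + m)
  have hD : 0 ≤ D := mul_nonneg (by positivity) (zpow_nonneg (EisensteinSeries.r_pos _).le _)
  have hsum : Summable fun y : Fin 2 → ℤ ↦ D * ‖y‖ ^ (p + q + m) :=
    (summable_norm_zpow hs).mul_left D
  refine ⟨∑' y : Fin 2 → ℤ, D * ‖y‖ ^ (p + q + m), fun z hz ↦ ?_⟩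
  -- The shear is chosen so that `cz + d = c(z - ⌊Re z⌋) + d'`, with `c` unchanged.
  let y : ι → Fin 2 → ℤ := fun i ↦ ![x i 0, x i 1 + ⌊z.re⌋ * x i 0]
  have hyinj : Function.Injective y := by
    intro i j hij
    have h0 : x i 0 = x j 0 := by simpa [y] using congrFun hij 0
    have h1 : x i 1 + ⌊z.re⌋ * x i 0 = x j 1 + ⌊z.re⌋ * x j 0 := by
      simpa [y] using congrFun hij 1
    rw [h0] at h1
    refine hinj (funext fun l ↦ ?_)
    fin_cases l
    · exact h0
    · exact add_right_cancel h1
  have hy (i : ι) : y i ≠ 0 := by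
    intro h
    have h0 : x i 0 = 0 := by simpa [y] using congrFun h 0
    have h1 : x i 1 = 0 := by simpa [y, h0] using congrFun h 1
    refine hx i (funext fun l ↦ ?_)
    fin_cases l
    · exact h0
    · exact h1
  have hterm (i : ι) : latTerm (x i) m p q z = latTerm (y i) m p q (z - ⌊z.re⌋) := by
    have : (x i 0 : ℂ) * z + x i 1 = (y i 0 : ℂ) * (z - ⌊z.re⌋) + y i 1 := by
      simp only [y, Matrix.cons_val_zero, Matrix.cons_val_one]
      push_cast
      ring
    rw [latTerm, latTerm, this]
    simp only [y, Matrix.cons_val_zero]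
  have hre : |(z - ⌊z.re⌋ : ℂ).re| ≤ 1 := by
    simp only [Complex.sub_re, Complex.intCast_re, Int.self_sub_floor]
    rw [abs_of_nonneg (Int.fract_nonneg _)]
    exact (Int.fract_lt_one _).le
  have hb (i : ι) : ‖a i * latTerm (x i) m p q z‖ ≤ D * ‖y i‖ ^ (p + q + m) := by
    rw [norm_mul, hterm]
    exact (mul_le_of_le_one_left (norm_nonneg _) (ha i)).trans
      (norm_latTerm_le (hy i) (by omega) one_pos hre (by simpa using hz))
  refine (tsum_of_norm_bounded (hsum.comp_injective hyinj).hasSum hb).trans ?_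
  exact tsum_comp_le_tsum_of_inj hsum
    (fun _ ↦ mul_nonneg hD (zpow_nonneg (norm_nonneg _) _)) hyinj

/-! ### The cosets `Γ_ρ \ Γ₀(N)` -/

lemma bottomRow_ne_zero (γ : SL(2, ℤ)) : (γ : Matrix (Fin 2) (Fin 2) ℤ) 1 ≠ 0 := by
  intro h
  have hdet := γ.det_coe
  rw [Matrix.det_fin_two, congrFun h 0, congrFun h 1] at hdet
  simp at hdet

lemma mem_cuspStabilizer_of_conj {N : ℕ} {ρ : OnePoint ℚ} {γρ : SL(2, ℤ)}
    (hρ : mapGL ℚ γρ • (OnePoint.infty : OnePoint ℚ) = ρ) {h : Gamma0 N}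
    (hh : (γρ⁻¹ * (h : SL(2, ℤ)) * γρ) 1 0 = 0) : h ∈ cuspStabilizer N ρ := by
  have h1 : mapGL ℚ (γρ⁻¹ * (h : SL(2, ℤ)) * γρ) • (OnePoint.infty : OnePoint ℚ)
      = OnePoint.infty := by
    generalize γρ⁻¹ * (h : SL(2, ℤ)) * γρ = m at hh ⊢
    rw [OnePoint.smul_infty_eq_self_iff]
    simpa using hh
  change mapGL ℚ (h : SL(2, ℤ)) • ρ = ρ
  rw [map_mul, map_mul, mul_smul, mul_smul, hρ, map_inv, inv_smul_eq_iff, hρ] at h1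
  exact h1

/-- If `A` and `B` share their bottom row, `A * B⁻¹` has lower left entry `0`. Here that quotient is
the conjugate by `γρ` of a quotient of representatives, which therefore fixes `ρ`. -/
lemma injective_bottomRow {N : ℕ} {ρ : OnePoint ℚ} {γρ : SL(2, ℤ)}
    (hρ : mapGL ℚ γρ • (OnePoint.infty : OnePoint ℚ) = ρ) (γ : SL(2, ℤ)) :
    Function.Injective fun c : CuspCosets N ρ ↦
      ((γρ⁻¹ * (c.out : SL(2, ℤ)) * γ : SL(2, ℤ)) : Matrix (Fin 2) (Fin 2) ℤ) 1 := by
  intro c₁ c₂ h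
  have hm : γρ⁻¹ * ((c₁.out * c₂.out⁻¹ : Gamma0 N) : SL(2, ℤ)) * γρ =
      (γρ⁻¹ * (c₁.out : SL(2, ℤ)) * γ) * (γρ⁻¹ * (c₂.out : SL(2, ℤ)) * γ)⁻¹ := by
    push_cast
    group
  have h10 : (γρ⁻¹ * ((c₁.out * c₂.out⁻¹ : Gamma0 N) : SL(2, ℤ)) * γρ) 1 0 = 0 := by
    rw [hm]
    dsimp only at h
    generalize γρ⁻¹ * (c₁.out : SL(2, ℤ)) * γ = A at h ⊢
    generalize γρ⁻¹ * (c₂.out : SL(2, ℤ)) * γ = B at h ⊢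
    rw [coe_mul, coe_inv, Matrix.mul_apply, Fin.sum_univ_two, Matrix.adjugate_fin_two, h]
    simp
    ring
  have hmem := mem_cuspStabilizer_of_conj hρ h10
  rw [← Quotient.out_eq c₁, ← Quotient.out_eq c₂]
  exact (Quotient.sound (QuotientGroup.rightRel_apply.mpr hmem)).symm

/-- Right multiplication by `g` on `Γ_ρ \ Γ₀(N)`. -/
def cosetMulRight {N : ℕ} (ρ : OnePoint ℚ) (g : Gamma0 N) (c : CuspCosets N ρ) :
    CuspCosets N ρ :=
  c.map (· * g) fun h₁ h₂ h ↦ by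
    rw [← Quotient.eq_iff_equiv, Quotient.eq, QuotientGroup.rightRel_apply] at h ⊢
    simpa [mul_assoc] using h

/-- Right multiplication by `g` on `Γ_ρ \ Γ₀(N)`, as a permutation. -/
def cosetMulRightEquiv {N : ℕ} (ρ : OnePoint ℚ) (g : Gamma0 N) :
    CuspCosets N ρ ≃ CuspCosets N ρ where
  toFun := cosetMulRight ρ g
  invFun := cosetMulRight ρ g⁻¹
  left_inv c := by
    induction c using Quotient.inductionOn with
    | h h => simp [cosetMulRight]
  right_inv c := by
    induction c using Quotient.inductionOn with
    | h h => simp [cosetMulRight]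

/-! ### The series -/

/-- Substitute `Im γτ = v / (j * conj j)`; the powers of `j` add up to `-k - (1 - k) = -1`. -/
lemma seed_slash_apply (k : ℤ) (γ : SL(2, ℤ)) (τ : ℍ) :
    (seed k ∣[k] γ) τ = (τ.im : ℂ) ^ (1 - k) / (1 - k) *
      latTerm ((γ : Matrix (Fin 2) (Fin 2) ℤ) 1) 0 (-1) (k - 1) τ := by
  have hd : denom γ τ = (γ 1 0 : ℂ) * τ + γ 1 1 := by simp [denom]
  have hj := linear_ne_zero (bottomRow_ne_zero γ) τ.im_pos
  have hj' : conj ((γ 1 0 : ℂ) * τ + γ 1 1) ≠ 0 := (map_ne_zero _).mpr hj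
  rw [ModularForm.SL_slash_apply, seed, ModularGroup.im_smul_eq_div_normSq, hd, Complex.ofReal_div,
    ← Complex.mul_conj, latTerm]
  have hk : k - 1 = -(1 - k) := by ring
  have hk' : -k = (1 - k) + -1 := by ring
  rw [hk, div_zpow, mul_zpow, hk', zpow_add₀ hj, zpow_neg _ (1 - k)]
  field_simp

variable {N : ℕ} {k : ℤ} {χ : DirichletCharacter ℂ N} {ρ : OnePoint ℚ} {γρ : SL(2, ℤ)}

lemma norm_conj_charVal_le (g : Gamma0 N) : ‖conj (charVal χ g)‖ ≤ 1 := by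
  rw [Complex.norm_conj]
  exact χ.norm_le_one _

/-- Both `χ(g)` and `χ(g⁻¹)` have norm at most `1` and their product is `1`, so `χ(g)` lies on the
unit circle. -/
lemma charVal_mul_conj (χ : DirichletCharacter ℂ N) (g : Gamma0 N) :
    charVal χ g * conj (charVal χ g) = 1 := by
  have hu : charVal χ g * charVal χ g⁻¹ = 1 := by
    rw [← charVal_mul, mul_inv_cancel]
    simp [charVal]
  have h1 : ‖charVal χ g‖ ≤ 1 := χ.norm_le_one _
  have h2 : ‖charVal χ g⁻¹‖ ≤ 1 := χ.norm_le_one _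
  have h3 : ‖charVal χ g‖ * ‖charVal χ g⁻¹‖ = 1 := by rw [← norm_mul, hu, norm_one]
  have h4 : ‖charVal χ g‖ = 1 := by nlinarith [norm_nonneg (charVal χ g)]
  rw [Complex.mul_conj, Complex.normSq_eq_norm_sq, h4]
  simp

/-- The coefficient of the coset `c` in `poincare`. -/
def cosetCoeff (χ : DirichletCharacter ℂ N) (ρ : OnePoint ℚ) (c : CuspCosets N ρ) : ℂ :=
  conj (charVal χ c.out)

/-- The bottom row of `γ_ρ⁻¹ g γ`, where `g` represents the coset `c`. -/
def cosetRow (ρ : OnePoint ℚ) (γρ γ : SL(2, ℤ)) (c : CuspCosets N ρ) : Fin 2 → ℤ :=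
  ((γρ⁻¹ * (c.out : SL(2, ℤ)) * γ : SL(2, ℤ)) : Matrix (Fin 2) (Fin 2) ℤ) 1

lemma norm_cosetCoeff_le (c : CuspCosets N ρ) : ‖cosetCoeff χ ρ c‖ ≤ 1 :=
  norm_conj_charVal_le c.out

lemma cosetRow_ne_zero (γ : SL(2, ℤ)) (c : CuspCosets N ρ) : cosetRow ρ γρ γ c ≠ 0 :=
  bottomRow_ne_zero _

lemma cosetRow_injective (hρ : mapGL ℚ γρ • (OnePoint.infty : OnePoint ℚ) = ρ) (γ : SL(2, ℤ)) :
    Function.Injective (cosetRow (N := N) ρ γρ γ) :=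
  injective_bottomRow hρ γ

/-- The slash by any `γ` passes through the sum over the fixed representatives. It serves both the
expansion at an arbitrary cusp and the transformation law. -/
lemma poincare_slash_apply_eq_tsum (γ : SL(2, ℤ)) (τ : ℍ) :
    (poincare k χ ρ γρ ∣[k] γ) τ =
      ∑' c : CuspCosets N ρ,
        conj (charVal χ c.out) * (seed k ∣[k] (γρ⁻¹ * (c.out : SL(2, ℤ)) * γ)) τ := by
  rw [ModularForm.SL_slash_apply, poincare, ← tsum_mul_right]
  refine tsum_congr fun c ↦ ?_
  rw [SlashAction.slash_mul, ModularForm.SL_slash_apply _ γ, poincareTerm, mul_assoc]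

lemma poincare_slash_apply (γ : SL(2, ℤ)) (τ : ℍ) :
    (poincare k χ ρ γρ ∣[k] γ) τ = (τ.im : ℂ) ^ (1 - k) / (1 - k) *
      latSum (cosetCoeff χ ρ) (cosetRow ρ γρ γ) 0 (-1) (k - 1) τ := by
  rw [poincare_slash_apply_eq_tsum, latSum, ← tsum_mul_left]
  refine tsum_congr fun c ↦ ?_
  rw [seed_slash_apply, cosetCoeff, cosetRow]
  ring

lemma poincare_apply (τ : ℍ) :
    poincare k χ ρ γρ τ = (τ.im : ℂ) ^ (1 - k) / (1 - k) *
      latSum (cosetCoeff χ ρ) (cosetRow ρ γρ 1) 0 (-1) (k - 1) τ := by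
  rw [← poincare_slash_apply, SlashAction.slash_one]

lemma poincareTerm_eq_latTerm (τ : ℍ) (c : CuspCosets N ρ) :
    poincareTerm k χ γρ τ c.out = (τ.im : ℂ) ^ (1 - k) / (1 - k) *
      (cosetCoeff χ ρ c * latTerm (cosetRow ρ γρ 1 c) 0 (-1) (k - 1) τ) := by
  rw [poincareTerm, seed_slash_apply, cosetCoeff, cosetRow, mul_one]
  ring

/-- Conjugation turns the antiholomorphic `(conj j)^(k-2)` into `j^(k-2)`, and `conj χ(g)` into the
coefficient attached to `star χ`. -/
lemma eisTerm_eq_latTerm (τ : ℍ) (c : CuspCosets N ρ) :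
    eisTerm (2 - k) (star χ) γρ τ c.out =
      conj (cosetCoeff χ ρ c * latTerm (cosetRow ρ γρ 1 c) 0 0 (k - 2) τ) := by
  have h : charVal (star χ) c.out = conj (charVal χ c.out) := MulChar.star_apply _ _
  rw [eisTerm, h, cosetCoeff, latTerm, cosetRow, mul_one, autFactor, neg_sub]
  simp [map_zpow₀]

/-! ### Absolute convergence, transformation law, growth and shadow -/

lemma summable_poincareTerm (hk : k < 0)
    (hρ : mapGL ℚ γρ • (OnePoint.infty : OnePoint ℚ) = ρ) (τ : ℍ) :
    Summable fun c : CuspCosets N ρ ↦ ‖poincareTerm k χ γρ τ c.out‖ := by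
  simp only [poincareTerm_eq_latTerm, norm_mul _ (cosetCoeff χ ρ _ * _)]
  exact (summable_norm_latTerm norm_cosetCoeff_le
    (cosetRow_ne_zero _) (cosetRow_injective hρ 1) (by push_cast; omega)
    τ.im_pos).mul_left _

lemma summable_eisTerm (hk : k < 0)
    (hρ : mapGL ℚ γρ • (OnePoint.infty : OnePoint ℚ) = ρ) (τ : ℍ) :
    Summable fun c : CuspCosets N ρ ↦ ‖eisTerm (2 - k) (star χ) γρ τ c.out‖ := by
  simp only [eisTerm_eq_latTerm, Complex.norm_conj]
  exact summable_norm_latTerm norm_cosetCoeff_le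
    (cosetRow_ne_zero _) (cosetRow_injective hρ 1) (by push_cast; omega) τ.im_pos

lemma poincare_slash_eq (hpar : χ (-1) = (-1) ^ k)
    (hρ : mapGL ℚ γρ • (OnePoint.infty : OnePoint ℚ) = ρ) (htriv : TrivialOnUnipotents χ ρ)
    (g : Gamma0 N) :
    poincare k χ ρ γρ ∣[k] (g : SL(2, ℤ)) = charVal χ g • poincare k χ ρ γρ := by
  ext τ
  rw [poincare_slash_apply_eq_tsum, Pi.smul_apply, poincare, smul_eq_mul,
    ← (cosetMulRightEquiv ρ g).tsum_eq (fun c ↦ poincareTerm k χ γρ τ c.out), ← tsum_mul_left]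
  refine tsum_congr fun c ↦ ?_
  -- The chosen representative of the translated coset need not be `c.out * g`, but differs from it
  -- by a left factor in `Γ_ρ`, which `poincareTerm` ignores.
  have hrel : (QuotientGroup.rightRel (cuspStabilizer N ρ)) (c.out * g)
      (cosetMulRightEquiv ρ g c).out := by
    refine Quotient.exact ?_
    rw [Quotient.out_eq]
    conv_rhs => rw [← Quotient.out_eq c]
    rfl
  have hout : (cosetMulRightEquiv ρ g c).out =
      ((cosetMulRightEquiv ρ g c).out * (c.out * g)⁻¹) * (c.out * g) := by group
  rw [hout, poincareTerm_stabilizer_mul hρ hpar htriv (QuotientGroup.rightRel_apply.mp hrel),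
    poincareTerm, charVal_mul, map_mul, Subgroup.coe_mul, ← mul_assoc γρ⁻¹]
  linear_combination (-conj (charVal χ c.out) *
    (seed k ∣[k] (γρ⁻¹ * (c.out : SL(2, ℤ)) * (g : SL(2, ℤ)))) τ) * charVal_mul_conj χ g

lemma poincare_polynomialGrowth (hk : k < 0)
    (hρ : mapGL ℚ γρ • (OnePoint.infty : OnePoint ℚ) = ρ) :
    PolynomialGrowthAtCusps k (poincare k χ ρ γρ) := by
  intro γ
  -- The exponent of growth is `n = 1 - k`, coming from the prefactor alone, as the lattice sum is
  -- bounded for `v ≥ 1`.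
  obtain ⟨n, hn⟩ := Int.eq_ofNat_of_zero_le (by omega : 0 ≤ 1 - k)
  obtain ⟨C, hC⟩ := exists_norm_latSum_le (a := cosetCoeff χ ρ) (x := cosetRow ρ γρ γ) (m := 0)
    (p := -1) (q := k - 1) norm_cosetCoeff_le (cosetRow_ne_zero _)
    (cosetRow_injective hρ γ) (by push_cast; omega)
  refine ⟨n, Asymptotics.IsBigO.of_bound (‖(1 - k : ℂ)‖⁻¹ * C) ?_⟩
  refine (atImInfty_mem _).mpr ⟨1, fun τ hτ ↦ ?_⟩
  change ‖(poincare k χ ρ γρ ∣[k] γ) τ‖ ≤ _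
  rw [poincare_slash_apply, hn, norm_mul, norm_div, zpow_natCast, norm_pow, norm_pow,
    Complex.norm_real]
  calc ‖τ.im‖ ^ n / ‖(1 - k : ℂ)‖ *
        ‖latSum (cosetCoeff χ ρ) (cosetRow ρ γρ γ) 0 (-1) (k - 1) τ‖
      ≤ ‖τ.im‖ ^ n / ‖(1 - k : ℂ)‖ * C := by gcongr; exact hC τ hτ
    _ = _ := by ring

lemma pow_im_isBigO_exp (n : ℕ) :
    (fun τ : ℍ ↦ τ.im ^ n) =O[atImInfty] fun τ : ℍ ↦ Real.exp (1 * τ.im) := by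
  refine Asymptotics.IsBigO.of_bound (n.factorial : ℝ) (Filter.Eventually.of_forall fun τ ↦ ?_)
  rw [Real.norm_of_nonneg (pow_nonneg τ.im_pos.le n), Real.norm_of_nonneg (Real.exp_pos _).le,
    one_mul, ← div_le_iff₀' (by positivity)]
  exact Real.pow_div_factorial_le_exp _ τ.im_pos.le n

lemma isManageable_poincare (hk : k < 0) (hpar : χ (-1) = (-1) ^ k)
    (hρ : mapGL ℚ γρ • (OnePoint.infty : OnePoint ℚ) = ρ) (htriv : TrivialOnUnipotents χ ρ) :
    IsManageable k χ (poincare k χ ρ γρ) where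
  smooth := isSmooth_of_eq_latSum norm_cosetCoeff_le
    (cosetRow_ne_zero _) (cosetRow_injective hρ 1) hk poincare_apply
  slash_eq := poincare_slash_eq hpar hρ htriv
  harmonic := laplacian_of_eq_latSum norm_cosetCoeff_le
    (cosetRow_ne_zero _) (cosetRow_injective hρ 1) hk poincare_apply
  growth γ := by
    obtain ⟨n, hn⟩ := poincare_polynomialGrowth (χ := χ) hk hρ γ
    exact ⟨1, one_pos, hn.trans (pow_im_isBigO_exp n)⟩

/-- The powers `v^k` and `v^(-k)` cancel, and `2i * conj (i/2) = 1`, leaving the conjugate of the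
antiholomorphic sum. -/
lemma shadow_poincare (hk : k < 0) (hρ : mapGL ℚ γρ • (OnePoint.infty : OnePoint ℚ) = ρ) :
    shadow k (poincare k χ ρ γρ) = eisenstein (2 - k) (star χ) ρ γρ := by
  ext τ
  have hv : (τ.im : ℂ) ≠ 0 := Complex.ofReal_ne_zero.mpr τ.im_pos.ne'
  rw [shadow, dBar_of_eq_latSum norm_cosetCoeff_le
    (cosetRow_ne_zero _) (cosetRow_injective hρ 1) hk poincare_apply, eisenstein,
    tsum_congr (eisTerm_eq_latTerm τ), ← Complex.conj_tsum, ← latSum]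
  simp only [map_mul, map_div₀, map_zpow₀, Complex.conj_I, Complex.conj_ofReal, map_ofNat]
  have hz : (τ.im : ℂ) ^ k * (τ.im : ℂ) ^ (-k) = 1 := by
    rw [← zpow_add₀ hv, add_neg_cancel, zpow_zero]
  set L := conj (latSum (cosetCoeff χ ρ) (cosetRow ρ γρ 1) 0 0 (k - 2) τ)
  linear_combination (-Complex.I ^ 2 * L) * hz - L * Complex.I_sq

end

end HarmonicMaass

theorem mainTheorem2 {N : ℕ} [NeZero N] (k : ℤ) (hk : k < 0) (χ : DirichletCharacter ℂ N)
    (hpar : χ (-1) = (-1) ^ k) (ρ : OnePoint ℚ) (γρ : SL(2, ℤ))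
    (hρ : Matrix.SpecialLinearGroup.mapGL ℚ γρ • (OnePoint.infty : OnePoint ℚ) = ρ)
    (htriv : HarmonicMaass.TrivialOnUnipotents χ ρ) :
    (∀ τ : UpperHalfPlane, Summable fun q : HarmonicMaass.CuspCosets N ρ =>
        ‖HarmonicMaass.poincareTerm k χ γρ τ q.out‖) ∧
      HarmonicMaass.IsManageable k χ (HarmonicMaass.poincare k χ ρ γρ) ∧
      HarmonicMaass.PolynomialGrowthAtCusps k (HarmonicMaass.poincare k χ ρ γρ) ∧
      HarmonicMaass.IsPolynomialGrowthForm k χ (HarmonicMaass.poincare k χ ρ γρ) ∧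
      (∀ τ : UpperHalfPlane, Summable fun q : HarmonicMaass.CuspCosets N ρ =>
        ‖HarmonicMaass.eisTerm (2 - k) (star χ) γρ τ q.out‖) ∧
      HarmonicMaass.shadow k (HarmonicMaass.poincare k χ ρ γρ) =
        HarmonicMaass.eisenstein (2 - k) (star χ) ρ γρ := by
  exact ⟨HarmonicMaass.summable_poincareTerm hk hρ,
    HarmonicMaass.isManageable_poincare hk hpar hρ htriv,
    HarmonicMaass.poincare_polynomialGrowth hk hρ,
    ⟨HarmonicMaass.isManageable_poincare hk hpar hρ htriv,
      HarmonicMaass.poincare_polynomialGrowth hk hρ⟩,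
    HarmonicMaass.summable_eisTerm hk hρ, HarmonicMaass.shadow_poincare hk hρ⟩
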